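/- Let $\mathrm{PLF}(\mathbb{R})$ be the group, under composition, of all homeomorphisms $f:\mathbb{R}\to\mathbb{R}$ that are locally affine at all but finitely many points of $\mathbb{R}$ (that is, for all but finitely many $x$, $f$ coincides with an affine map $y\mapsto ay+b$ on a neighbourhood of $x$). For $f\in\mathrm{PLF}(\mathbb{R})$ let $\gamma_L(f)$ and $\gamma_R(f)$ denote the leftmost and rightmost gradients of $f$: the unique real numbers such that, for some constants $b,b'$, $f(x)=\gamma_L(f)\,x+b$ for all sufficiently negative $x$ and $f(x)=\gamma_R(f)\,x+b'$ for all sufficiently large $x$. Put \[ \mathrm{PLE}(\mathbb{R})=\left\{f\in\mathrm{PLF}(\mathbb{R})\;\middle|\;\gamma_R(f)=\frac{1}{\gamma_L(f)}\right\}. \] Then the subgroup of $\mathrm{PLF}(\mathbb{R})$ generated by the involutions of $\mathrm{PLF}(\mathbb{R})$ (the elements $\tau$ with $\tau^2=\mathrm{id}$) is equal to $\mathrm{PLE}(\mathbb{R})$. -/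

import Mathlib

open Filter Topology

/-- `f` coincides with an affine map on a neighbourhood of `x`. -/
def LocallyAffineAt (f : ℝ → ℝ) (x : ℝ) : Prop :=
  ∃ a b : ℝ, ∀ᶠ y in 𝓝 x, f y = a * y + b

theorem LocallyAffineAt.comp {f g : ℝ → ℝ} {x : ℝ} (hg : LocallyAffineAt g x)
    (hc : ContinuousAt g x) (hf : LocallyAffineAt f (g x)) :
    LocallyAffineAt (fun y => f (g y)) x := by
  obtain ⟨a, b, hab⟩ := hg
  obtain ⟨c, d, hcd⟩ := hf
  refine ⟨c * a, c * b + d, ?_⟩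
  filter_upwards [hab, hc.eventually hcd] with y h1 h2
  rw [h2, h1]
  ring

theorem LocallyAffineAt.symm {f : ℝ ≃ₜ ℝ} {x : ℝ} (hf : LocallyAffineAt f (f.symm x)) :
    LocallyAffineAt f.symm x := by
  obtain ⟨a, b, hab⟩ := hf
  have ha : a ≠ 0 := by
    rintro rfl
    have h1 : ∀ᶠ y in 𝓝[≠] (f.symm x), f y = 0 * y + b := hab.filter_mono nhdsWithin_le_nhds
    obtain ⟨y, hy, hne⟩ := (h1.and self_mem_nhdsWithin).exists
    have h2 := hab.self_of_nhds
    exact hne (f.injective (by rw [hy, h2]; ring))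
  refine ⟨a⁻¹, -(a⁻¹ * b), ?_⟩
  filter_upwards [(f.symm.continuous.continuousAt (x := x)).eventually hab] with y hy
  rw [f.apply_symm_apply] at hy
  nth_rewrite 2 [hy]
  field_simp
  ring

/-- The group of piecewise linear homeomorphisms of the real line that are locally affine
at all but finitely many points; multiplication is composition. -/
def PLF : Subgroup (ℝ ≃ₜ ℝ) where
  carrier := {f | {x : ℝ | ¬ LocallyAffineAt f x}.Finite}
  one_mem' := by
    refine Set.Finite.subset Set.finite_empty fun x hx => hx ⟨1, 0, ?_⟩
    exact Eventually.of_forall fun y => by simp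
  mul_mem' := by
    intro f g hf hg
    refine Set.Finite.subset (hg.union (hf.preimage g.injective.injOn)) fun x hx => ?_
    by_contra h
    simp only [Set.mem_union, Set.mem_preimage, Set.mem_ofPred_eq, not_or, not_not] at h
    exact hx (h.1.comp g.continuous.continuousAt h.2)
  inv_mem' := by
    intro f hf
    refine Set.Finite.subset (hf.preimage f.symm.injective.injOn) fun x hx => ?_
    exact fun h => hx (LocallyAffineAt.symm h)

theorem exists_affine_of_locallyAffineAt {f : ℝ → ℝ} {s : Set ℝ} (hs : IsOpen s)
    (hc : IsPreconnected s) (h : ∀ x ∈ s, LocallyAffineAt f x) :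
    ∃ a b : ℝ, ∀ x ∈ s, f x = a * x + b := by
  have key : ∀ x ∈ s, ∃ a b : ℝ, f =ᶠ[𝓝 x] fun y => a * y + b := h
  have hder : ∀ a b y : ℝ, HasDerivAt (fun z : ℝ => a * z + b) a y := fun a b y => by
    simpa using ((hasDerivAt_id y).const_mul a).add_const b
  have hd : ∀ x ∈ s, DifferentiableAt ℝ f x := fun x hx => by
    obtain ⟨a, b, hab⟩ := key x hx
    exact ((hder a b x).congr_of_eventuallyEq hab).differentiableAt
  have hd2 : ∀ x ∈ s, HasDerivAt (deriv f) 0 x := fun x hx => by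
    obtain ⟨a, b, hab⟩ := key x hx
    refine (hasDerivAt_const x a).congr_of_eventuallyEq (hab.deriv.trans ?_)
    exact Eventually.of_forall fun y => (hder a b y).deriv
  obtain ⟨a, ha⟩ := hs.exists_is_const_of_deriv_eq_zero hc
    (fun x hx => (hd2 x hx).differentiableAt.differentiableWithinAt)
    (fun x hx => (hd2 x hx).deriv)
  have hd3 : ∀ x ∈ s, HasDerivAt (fun y => f y - a * y) 0 x := fun x hx => by
    have h1 := (hd x hx).hasDerivAt.sub (by simpa using hder a 0 x : HasDerivAt (fun z : ℝ => a * z) a x)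
    rw [ha x hx, sub_self] at h1
    exact h1
  obtain ⟨b, hb⟩ := hs.exists_is_const_of_deriv_eq_zero hc
    (fun x hx => (hd3 x hx).differentiableAt.differentiableWithinAt)
    (fun x hx => (hd3 x hx).deriv)
  exact ⟨a, b, fun x hx => by linarith [hb x hx]⟩

theorem PLF.exists_affine_atBot (f : PLF) :
    ∃ a b : ℝ, ∀ᶠ x in atBot, (f : ℝ ≃ₜ ℝ) x = a * x + b := by
  obtain ⟨M, hM⟩ := Set.Finite.bddBelow f.2
  obtain ⟨a, b, hab⟩ := exists_affine_of_locallyAffineAt (f := (f : ℝ ≃ₜ ℝ)) (s := Set.Iio M)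
    isOpen_Iio isPreconnected_Iio
    (fun x hx => by_contra fun h => absurd (hM h) (not_le.2 hx))
  exact ⟨a, b, (eventually_lt_atBot M).mono fun x hx => hab x hx⟩

theorem PLF.exists_affine_atTop (f : PLF) :
    ∃ a b : ℝ, ∀ᶠ x in atTop, (f : ℝ ≃ₜ ℝ) x = a * x + b := by
  obtain ⟨M, hM⟩ := Set.Finite.bddAbove f.2
  obtain ⟨a, b, hab⟩ := exists_affine_of_locallyAffineAt (f := (f : ℝ ≃ₜ ℝ)) (s := Set.Ioi M)
    isOpen_Ioi isPreconnected_Ioi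
    (fun x hx => by_contra fun h => absurd (hM h) (not_le.2 hx))
  exact ⟨a, b, (eventually_gt_atTop M).mono fun x hx => hab x hx⟩

/-- The leftmost gradient of `f`: the (unique) slope `a` with `f x = a * x + b` for all
sufficiently negative `x`. -/
noncomputable def PLF.leftGradient (f : PLF) : ℝ := (PLF.exists_affine_atBot f).choose

/-- The rightmost gradient of `f`: the (unique) slope `a` with `f x = a * x + b` for all
sufficiently large `x`. -/
noncomputable def PLF.rightGradient (f : PLF) : ℝ := (PLF.exists_affine_atTop f).choose

/-- The elements of `PLF` whose rightmost gradient is the reciprocal of the leftmost one. -/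
def PLE : Set PLF := {f | PLF.rightGradient f = 1 / PLF.leftGradient f}

/-- The involutions of a group: the elements whose square is the identity
(the identity itself is included). -/
def involutions (G : Type*) [Group G] : Set G := {τ | τ ^ 2 = 1}

/-- The subgroup of `G` generated by the involutions of `G`. -/
def involutionSubgroup (G : Type*) [Group G] : Subgroup G := Subgroup.closure (involutions G)

/-! The product of the two extreme gradients is multiplicative on `PLF`: a decreasing map swaps the
two ends, but the product is symmetric in them (`PLF.gradientProduct`). It is positive, so it equals
1 on every involution, and `PLE` is its kernel. This gives one inclusion.

For the other, `PLF` is generated by involutions together with the bends at the origin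
(`bendSubgroup_eq_top`): reflections yield translations, bends and reflections yield scalings, and a
translated bend removes a break point. The involutions generate a normal subgroup, so every element
is `n * PLF.bend c` with `n` in that subgroup. Its gradient product is `c`, hence in `PLE` the bend
is trivial. -/

/-! ### Gradients -/

/-- Two lines that meet at two distinct points have the same slope; `hl` supplies the second point.
-/
theorem affine_unique_of_eventually {l : Filter ℝ} [l.NeBot] (hl : ∀ x, ∀ᶠ y in l, y ≠ x)
    {a b a' b' : ℝ} (h : ∀ᶠ x in l, a * x + b = a' * x + b') : a = a' := by
  obtain ⟨x, hx⟩ := h.exists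
  obtain ⟨y, hy, hyx⟩ := (h.and (hl x)).exists
  have h1 : (a - a') * (y - x) = 0 := by linear_combination hy - hx
  rcases mul_eq_zero.1 h1 with h2 | h2
  · linarith
  · exact absurd (sub_eq_zero.1 h2) hyx

theorem PLF.leftGradient_eq {f : PLF} {a b : ℝ}
    (h : ∀ᶠ x in atBot, (f : ℝ ≃ₜ ℝ) x = a * x + b) : PLF.leftGradient f = a := by
  obtain ⟨b', hb'⟩ := (PLF.exists_affine_atBot f).choose_spec
  refine affine_unique_of_eventually (l := atBot) (b := b') (b' := b)
    (fun x => eventually_ne_atBot x) ?_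
  filter_upwards [h, hb'] with x h1 h2
  exact h2.symm.trans h1

theorem PLF.rightGradient_eq {f : PLF} {a b : ℝ}
    (h : ∀ᶠ x in atTop, (f : ℝ ≃ₜ ℝ) x = a * x + b) : PLF.rightGradient f = a := by
  obtain ⟨b', hb'⟩ := (PLF.exists_affine_atTop f).choose_spec
  refine affine_unique_of_eventually (l := atTop) (b := b') (b' := b)
    (fun x => eventually_ne_atTop x) ?_
  filter_upwards [h, hb'] with x h1 h2
  exact h2.symm.trans h1

theorem PLF.leftGradient_spec (f : PLF) :
    ∃ b : ℝ, ∀ᶠ x in atBot, (f : ℝ ≃ₜ ℝ) x = PLF.leftGradient f * x + b :=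
  (PLF.exists_affine_atBot f).choose_spec

theorem PLF.rightGradient_spec (f : PLF) :
    ∃ b : ℝ, ∀ᶠ x in atTop, (f : ℝ ≃ₜ ℝ) x = PLF.rightGradient f * x + b :=
  (PLF.exists_affine_atTop f).choose_spec

theorem PLF.strictMono_or_strictAnti (f : PLF) :
    StrictMono (f : ℝ ≃ₜ ℝ) ∨ StrictAnti (f : ℝ ≃ₜ ℝ) :=
  (f : ℝ ≃ₜ ℝ).continuous.strictMono_of_inj (f : ℝ ≃ₜ ℝ).injective

theorem StrictMono.slope_pos {f : ℝ → ℝ} (hf : StrictMono f) {a b x y : ℝ} (hxy : x < y)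
    (hx : f x = a * x + b) (hy : f y = a * y + b) : 0 < a := by
  have h1 := hf hxy
  rw [hx, hy] at h1
  by_contra h
  nlinarith

theorem StrictAnti.slope_neg {f : ℝ → ℝ} (hf : StrictAnti f) {a b x y : ℝ} (hxy : x < y)
    (hx : f x = a * x + b) (hy : f y = a * y + b) : a < 0 := by
  have h1 := hf hxy
  rw [hx, hy] at h1
  by_contra h
  nlinarith

theorem PLF.exists_lt_leftGradient (f : PLF) : ∃ b x y : ℝ, x < y ∧
    (f : ℝ ≃ₜ ℝ) x = PLF.leftGradient f * x + b ∧
    (f : ℝ ≃ₜ ℝ) y = PLF.leftGradient f * y + b := by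
  obtain ⟨b, hb⟩ := PLF.leftGradient_spec f
  obtain ⟨y, hy⟩ := hb.exists
  obtain ⟨x, hx, hxy⟩ := (hb.and (eventually_lt_atBot y)).exists
  exact ⟨b, x, y, hxy, hx, hy⟩

theorem PLF.exists_lt_rightGradient (f : PLF) : ∃ b x y : ℝ, x < y ∧
    (f : ℝ ≃ₜ ℝ) x = PLF.rightGradient f * x + b ∧
    (f : ℝ ≃ₜ ℝ) y = PLF.rightGradient f * y + b := by
  obtain ⟨b, hb⟩ := PLF.rightGradient_spec f
  obtain ⟨x, hx⟩ := hb.exists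
  obtain ⟨y, hy, hxy⟩ := (hb.and (eventually_gt_atTop x)).exists
  exact ⟨b, x, y, hxy, hx, hy⟩

theorem PLF.gradients_pos {f : PLF} (hf : StrictMono (f : ℝ ≃ₜ ℝ)) :
    0 < PLF.leftGradient f ∧ 0 < PLF.rightGradient f := by
  obtain ⟨b, x, y, hxy, hx, hy⟩ := PLF.exists_lt_leftGradient f
  obtain ⟨b', x', y', hxy', hx', hy'⟩ := PLF.exists_lt_rightGradient f
  exact ⟨hf.slope_pos hxy hx hy, hf.slope_pos hxy' hx' hy'⟩

theorem PLF.gradients_neg {f : PLF} (hf : StrictAnti (f : ℝ ≃ₜ ℝ)) :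
    PLF.leftGradient f < 0 ∧ PLF.rightGradient f < 0 := by
  obtain ⟨b, x, y, hxy, hx, hy⟩ := PLF.exists_lt_leftGradient f
  obtain ⟨b', x', y', hxy', hx', hy'⟩ := PLF.exists_lt_rightGradient f
  exact ⟨hf.slope_neg hxy hx hy, hf.slope_neg hxy' hx' hy'⟩

/-- Here `l'` is the end to which `g` sends the end `l`: the same end if `g` increases, the opposite
one if it decreases. -/
theorem PLF.eventually_mul_affine {f g : PLF} {l l' : Filter ℝ} {a b c d : ℝ}
    (hf : ∀ᶠ x in l', (f : ℝ ≃ₜ ℝ) x = a * x + b)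
    (hg : ∀ᶠ x in l, (g : ℝ ≃ₜ ℝ) x = c * x + d)
    (hl : Tendsto (fun x => c * x + d) l l') :
    ∀ᶠ x in l, ((f * g : PLF) : ℝ ≃ₜ ℝ) x = (a * c) * x + (a * d + b) := by
  filter_upwards [hl.eventually hf, hg] with x h1 h2
  change (f : ℝ ≃ₜ ℝ) ((g : ℝ ≃ₜ ℝ) x) = _
  rw [h2, h1]
  ring

/-- The product of the leftmost and rightmost gradients, as a homomorphism. -/
noncomputable def PLF.gradientProduct : PLF →* ℝ where
  toFun f := PLF.leftGradient f * PLF.rightGradient f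
  map_one' := by
    rw [PLF.leftGradient_eq (f := 1) (a := 1) (b := 0) (Eventually.of_forall fun x => by simp),
      PLF.rightGradient_eq (f := 1) (a := 1) (b := 0) (Eventually.of_forall fun x => by simp)]
    norm_num
  map_mul' f g := by
    obtain ⟨b, hb⟩ := PLF.leftGradient_spec f
    obtain ⟨b', hb'⟩ := PLF.rightGradient_spec f
    obtain ⟨d, hd⟩ := PLF.leftGradient_spec g
    obtain ⟨d', hd'⟩ := PLF.rightGradient_spec g
    rcases PLF.strictMono_or_strictAnti g with hg | hg
    · obtain ⟨h1, h2⟩ := PLF.gradients_pos hg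
      rw [PLF.leftGradient_eq (f := f * g) (PLF.eventually_mul_affine hb hd
          (tendsto_atBot_add_const_right _ _ (tendsto_id.const_mul_atBot h1))),
        PLF.rightGradient_eq (f := f * g) (PLF.eventually_mul_affine hb' hd'
          (tendsto_atTop_add_const_right _ _ (tendsto_id.const_mul_atTop h2)))]
      ring
    · obtain ⟨h1, h2⟩ := PLF.gradients_neg hg
      rw [PLF.leftGradient_eq (f := f * g) (PLF.eventually_mul_affine hb' hd
          (tendsto_atTop_add_const_right _ _ (tendsto_id.const_mul_atBot_of_neg h1))),
        PLF.rightGradient_eq (f := f * g) (PLF.eventually_mul_affine hb hd'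
          (tendsto_atBot_add_const_right _ _ (tendsto_id.const_mul_atTop_of_neg h2)))]
      ring

theorem PLF.gradientProduct_pos (f : PLF) : 0 < PLF.gradientProduct f := by
  rcases PLF.strictMono_or_strictAnti f with hf | hf
  · exact mul_pos (PLF.gradients_pos hf).1 (PLF.gradients_pos hf).2
  · exact mul_pos_of_neg_of_neg (PLF.gradients_neg hf).1 (PLF.gradients_neg hf).2

theorem mem_PLE_iff {f : PLF} : f ∈ PLE ↔ PLF.gradientProduct f = 1 := by
  have h0 : PLF.leftGradient f ≠ 0 := left_ne_zero_of_mul (PLF.gradientProduct_pos f).ne'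
  change PLF.rightGradient f = 1 / PLF.leftGradient f ↔
    PLF.leftGradient f * PLF.rightGradient f = 1
  rw [eq_div_iff h0, mul_comm]

/-! ### The subgroup generated by involutions -/

theorem gradientProduct_eq_one_of_mem_involutionSubgroup {f : PLF}
    (hf : f ∈ involutionSubgroup PLF) : PLF.gradientProduct f = 1 := by
  have h : involutionSubgroup PLF ≤ PLF.gradientProduct.ker := by
    refine (Subgroup.closure_le _).2 fun τ (hτ : τ ^ 2 = 1) => ?_
    have h1 := congrArg PLF.gradientProduct hτ
    rw [map_pow, map_one] at h1
    -- Positivity excludes the root -1.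
    exact (pow_eq_one_iff_of_nonneg (PLF.gradientProduct_pos τ).le two_ne_zero).1 h1
  exact h hf

theorem mem_involutionSubgroup_of_sq_eq_one {G : Type*} [Group G] {τ : G} (h : τ ^ 2 = 1) :
    τ ∈ involutionSubgroup G :=
  Subgroup.subset_closure h

/-- Conjugates of involutions are involutions. -/
instance involutionSubgroup_normal (G : Type*) [Group G] : (involutionSubgroup G).Normal where
  conj_mem n hn g := by
    have h : involutionSubgroup G ≤ (involutionSubgroup G).comap (MulAut.conj g).toMonoidHom := by
      refine (Subgroup.closure_le _).2 fun τ (hτ : τ ^ 2 = 1) => ?_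
      refine mem_involutionSubgroup_of_sq_eq_one ?_
      rw [← map_pow, hτ, map_one]
    exact h hn

/-! ### Translations, scalings and bends -/

/-- The affine homeomorphism `x ↦ a * x + b`. -/
noncomputable def PLF.affine (a b : ℝ) (ha : a ≠ 0) : PLF where
  val :=
    { toFun := fun x => a * x + b
      invFun := fun x => a⁻¹ * (x - b)
      left_inv := fun x => by field_simp; ring
      right_inv := fun x => by field_simp; ring
      continuous_toFun := by fun_prop
      continuous_invFun := by fun_prop }
  property := Set.finite_empty.subset fun _ hx => hx ⟨a, b, Eventually.of_forall fun _ => rfl⟩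

@[simp]
theorem PLF.affine_apply (a b : ℝ) (ha : a ≠ 0) (x : ℝ) :
    (PLF.affine a b ha : ℝ ≃ₜ ℝ) x = a * x + b := rfl

/-- The identity on negative numbers and multiplication by `c` on positive ones. -/
noncomputable def bendFun (c x : ℝ) : ℝ := x + (c - 1) * max x 0

theorem bendFun_of_nonneg (c : ℝ) {x : ℝ} (hx : 0 ≤ x) : bendFun c x = c * x := by
  rw [bendFun, max_eq_left hx]; ring

theorem bendFun_of_nonpos (c : ℝ) {x : ℝ} (hx : x ≤ 0) : bendFun c x = x := by
  rw [bendFun, max_eq_right hx]; ring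

theorem bendFun_bendFun (c : ℝ) {d : ℝ} (hd : 0 < d) (x : ℝ) :
    bendFun c (bendFun d x) = bendFun (c * d) x := by
  rcases le_total 0 x with hx | hx
  · rw [bendFun_of_nonneg d hx, bendFun_of_nonneg _ hx, bendFun_of_nonneg _ (by positivity)]; ring
  · rw [bendFun_of_nonpos d hx, bendFun_of_nonpos _ hx, bendFun_of_nonpos _ hx]

theorem bendFun_one (x : ℝ) : bendFun 1 x = x := by simp [bendFun]

theorem continuous_bendFun (c : ℝ) : Continuous (bendFun c) := by
  unfold bendFun; fun_prop

theorem locallyAffineAt_bendFun (c : ℝ) {x : ℝ} (hx : x ≠ 0) :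
    LocallyAffineAt (bendFun c) x := by
  rcases hx.lt_or_gt with h | h
  · exact ⟨1, 0, (eventually_lt_nhds h).mono fun y hy => by
      rw [bendFun_of_nonpos c (le_of_lt hy)]; ring⟩
  · exact ⟨c, 0, (eventually_gt_nhds h).mono fun y hy => by
      rw [bendFun_of_nonneg c (le_of_lt hy)]; ring⟩

/-- `bendFun` as a homomorphism from the positive reals. -/
noncomputable def PLF.bend : {c : ℝ // 0 < c} →* PLF where
  toFun c :=
    { val :=
        { toFun := bendFun c
          invFun := bendFun (c : ℝ)⁻¹
          left_inv := fun x => by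
            rw [bendFun_bendFun _ c.2, inv_mul_cancel₀ c.2.ne', bendFun_one]
          right_inv := fun x => by
            rw [bendFun_bendFun _ (inv_pos.2 c.2), mul_inv_cancel₀ c.2.ne', bendFun_one]
          continuous_toFun := continuous_bendFun _
          continuous_invFun := continuous_bendFun _ }
      property := (Set.finite_singleton 0).subset fun x hx => by
        by_contra h
        exact hx (locallyAffineAt_bendFun c h) }
  map_one' := Subtype.ext (Homeomorph.ext bendFun_one)
  map_mul' c d := Subtype.ext (Homeomorph.ext fun x => (bendFun_bendFun c d.2 x).symm)

@[simp]
theorem PLF.bend_apply (c : {c : ℝ // 0 < c}) (x : ℝ) :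
    (PLF.bend c : ℝ ≃ₜ ℝ) x = bendFun c x := rfl

theorem PLF.gradientProduct_bend (c : {c : ℝ // 0 < c}) :
    PLF.gradientProduct (PLF.bend c) = c := by
  change PLF.leftGradient _ * PLF.rightGradient _ = _
  rw [PLF.leftGradient_eq (f := PLF.bend c) (a := 1) (b := 0),
    PLF.rightGradient_eq (f := PLF.bend c) (a := c) (b := 0), one_mul]
  · filter_upwards [eventually_ge_atTop 0] with x hx
    rw [PLF.bend_apply, bendFun_of_nonneg _ hx, add_zero]
  · filter_upwards [eventually_le_atBot 0] with x hx
    rw [PLF.bend_apply, bendFun_of_nonpos _ hx, one_mul, add_zero]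

/-- The subgroup generated by the involutions and the bends at the origin. -/
noncomputable def bendSubgroup : Subgroup PLF := involutionSubgroup PLF ⊔ PLF.bend.range

theorem affine_neg_one_mem_involutionSubgroup (b : ℝ) :
    PLF.affine (-1) b (by norm_num) ∈ involutionSubgroup PLF := by
  refine mem_involutionSubgroup_of_sq_eq_one (Subtype.ext (Homeomorph.ext fun x => ?_))
  rw [sq]
  change -1 * (-1 * x + b) + b = x
  ring

theorem bend_mem_bendSubgroup (c : {c : ℝ // 0 < c}) : PLF.bend c ∈ bendSubgroup :=
  (le_sup_right : PLF.bend.range ≤ _) ⟨c, rfl⟩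

theorem affine_neg_one_mem_bendSubgroup (b : ℝ) :
    PLF.affine (-1) b (by norm_num) ∈ bendSubgroup :=
  (le_sup_left : involutionSubgroup PLF ≤ _) (affine_neg_one_mem_involutionSubgroup b)

theorem affine_one_mem_bendSubgroup (b : ℝ) :
    PLF.affine 1 b one_ne_zero ∈ bendSubgroup := by
  convert mul_mem (affine_neg_one_mem_bendSubgroup b) (affine_neg_one_mem_bendSubgroup 0) using 1
  refine Subtype.ext (Homeomorph.ext fun x => ?_)
  change 1 * x + b = -1 * (-1 * x + 0) + b
  ring

/-- Conjugated by `x ↦ -x`, the bend scales the negative half-line instead; composing it with the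
bend itself scales both halves by `a`. -/
theorem affine_mem_bendSubgroup_of_pos {a : ℝ} (ha : 0 < a) (b : ℝ) :
    PLF.affine a b ha.ne' ∈ bendSubgroup := by
  have hσ := affine_neg_one_mem_bendSubgroup 0
  have hB := bend_mem_bendSubgroup ⟨a, ha⟩
  convert mul_mem (affine_one_mem_bendSubgroup b) (mul_mem hB (mul_mem hσ (mul_mem hB hσ))) using 1
  refine Subtype.ext (Homeomorph.ext fun x => ?_)
  change a * x + b = 1 * bendFun a (-1 * bendFun a (-1 * x + 0) + 0) + b
  rcases le_total 0 x with hx | hx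
  · rw [bendFun_of_nonpos a (x := -1 * x + 0) (by linarith),
      bendFun_of_nonneg a (by linarith)]
    ring
  · rw [bendFun_of_nonneg a (x := -1 * x + 0) (by linarith),
      bendFun_of_nonpos a (by nlinarith)]
    ring

/-! ### Removing break points -/

/-- The finite set of points at which `f` is not locally affine. -/
def PLF.breaks (f : PLF) : Set ℝ := {x | ¬ LocallyAffineAt (f : ℝ ≃ₜ ℝ) x}

theorem PLF.exists_affine_both_sides (f : PLF) (p : ℝ) : ∃ a a' q r : ℝ, q < p ∧ p < r ∧
    (∀ x ∈ Set.Icc q p, (f : ℝ ≃ₜ ℝ) x = a * (x - p) + (f : ℝ ≃ₜ ℝ) p) ∧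
    ∀ x ∈ Set.Icc p r, (f : ℝ ≃ₜ ℝ) x = a' * (x - p) + (f : ℝ ≃ₜ ℝ) p := by
  have hev : ∀ᶠ x in 𝓝[≠] p, LocallyAffineAt (f : ℝ ≃ₜ ℝ) x := by
    -- The breaks other than `p` form a finite, hence closed, set.
    have h1 : (PLF.breaks f \ {p})ᶜ ∈ 𝓝 p :=
      (f.2.subset Set.sdiff_subset).isClosed.isOpen_compl.mem_nhds fun h => h.2 rfl
    filter_upwards [nhdsWithin_le_nhds h1, self_mem_nhdsWithin] with x hx hxp
    by_contra h
    exact hx ⟨h, hxp⟩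
  have extend : ∀ {u v : ℝ}, u < v → (∀ x ∈ Set.Ioo u v, LocallyAffineAt (f : ℝ ≃ₜ ℝ) x) →
      ∃ a b : ℝ, ∀ x ∈ Set.Icc u v, (f : ℝ ≃ₜ ℝ) x = a * x + b := by
    intro u v huv h
    obtain ⟨a, b, hab⟩ := exists_affine_of_locallyAffineAt isOpen_Ioo isPreconnected_Ioo h
    refine ⟨a, b, fun x hx => ?_⟩
    have h2 : Set.EqOn (f : ℝ ≃ₜ ℝ) (fun x => a * x + b) (closure (Set.Ioo u v)) :=
      Set.EqOn.closure hab (f : ℝ ≃ₜ ℝ).continuous (by fun_prop)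
    rw [closure_Ioo huv.ne] at h2
    exact h2 hx
  rw [eventually_nhdsWithin_iff, Metric.eventually_nhds_iff] at hev
  obtain ⟨ε, hε, hev⟩ := hev
  obtain ⟨a, b, hab⟩ := extend (u := p - ε) (v := p) (by linarith) fun x hx =>
    hev (by rw [Real.dist_eq, abs_lt]; constructor <;> linarith [hx.1, hx.2]) hx.2.ne
  obtain ⟨a', b', hab'⟩ := extend (u := p) (v := p + ε) (by linarith) fun x hx =>
    hev (by rw [Real.dist_eq, abs_lt]; constructor <;> linarith [hx.1, hx.2]) hx.1.ne'
  refine ⟨a, a', p - ε, p + ε, by linarith, by linarith, fun x hx => ?_, fun x hx => ?_⟩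
  · rw [hab x hx, hab p ⟨by linarith, le_rfl⟩]; ring
  · rw [hab' x hx, hab' p ⟨le_rfl, by linarith⟩]; ring

/-- Precompose with a bend carried to `p`. It cancels the change of slope at `p`, and its own only
possible break, 0, is sent to `p`, so no new break arises. -/
theorem PLF.exists_remove_break {f : PLF} (hf : StrictMono (f : ℝ ≃ₜ ℝ)) {p : ℝ}
    (hp : p ∈ PLF.breaks f) : ∃ g ∈ bendSubgroup, StrictMono (g : ℝ ≃ₜ ℝ) ∧
      (PLF.breaks (f * g)).ncard < (PLF.breaks f).ncard := by
  obtain ⟨a, a', q, r, hq, hr, hl, hR⟩ := PLF.exists_affine_both_sides f p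
  have ha : 0 < a := hf.slope_pos (b := (f : ℝ ≃ₜ ℝ) p - a * p) hq
    (by rw [hl q ⟨le_rfl, hq.le⟩]; ring) (by ring)
  have ha' : 0 < a' := hf.slope_pos (b := (f : ℝ ≃ₜ ℝ) p - a' * p) hr
    (by ring) (by rw [hR r ⟨hr.le, le_rfl⟩]; ring)
  -- The factor turns the right slope `a'` into `a' * (a / a') = a`, matching the left slope.
  have hc : 0 < a / a' := div_pos ha ha'
  set g : PLF := PLF.affine 1 p one_ne_zero * PLF.bend ⟨a / a', hc⟩ with hg
  have hgx : ∀ x, (g : ℝ ≃ₜ ℝ) x = 1 * bendFun (a / a') x + p := fun x => rfl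
  have hg0 : (g : ℝ ≃ₜ ℝ) 0 = p := by
    rw [hgx, bendFun_of_nonneg _ le_rfl]; ring
  have hmono : StrictMono (g : ℝ ≃ₜ ℝ) := by
    refine (PLF.strictMono_or_strictAnti g).resolve_right fun h => ?_
    have h1 := h (show (-1 : ℝ) < 0 by norm_num)
    rw [hg0, hgx, bendFun_of_nonpos _ (by norm_num)] at h1
    linarith
  refine ⟨g, mul_mem (affine_one_mem_bendSubgroup p) (bend_mem_bendSubgroup _), hmono, ?_⟩
  have hsub : PLF.breaks (f * g) ⊆ (g : ℝ ≃ₜ ℝ).symm '' (PLF.breaks f \ {p}) := by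
    intro y hy
    have hy0 : y ≠ 0 := by
      rintro rfl
      refine hy ⟨a, (f : ℝ ≃ₜ ℝ) p, ?_⟩
      have hnear : ∀ᶠ y in 𝓝 (0 : ℝ), (g : ℝ ≃ₜ ℝ) y ∈ Set.Ioo q r :=
        (g : ℝ ≃ₜ ℝ).continuous.continuousAt.eventually (hg0 ▸ Ioo_mem_nhds hq hr)
      filter_upwards [hnear] with y hy
      change (f : ℝ ≃ₜ ℝ) ((g : ℝ ≃ₜ ℝ) y) = _
      rcases le_total 0 y with h | h
      · rw [hR _ ⟨hg0 ▸ hmono.monotone h, hy.2.le⟩, hgx, bendFun_of_nonneg _ h]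
        field_simp
        ring
      · rw [hl _ ⟨hy.1.le, (hmono.monotone h).trans hg0.le⟩, hgx, bendFun_of_nonpos _ h]
        ring
    refine ⟨(g : ℝ ≃ₜ ℝ) y, ⟨fun h => hy ?_, fun h => hy0 ?_⟩, (g : ℝ ≃ₜ ℝ).symm_apply_apply y⟩
    · refine LocallyAffineAt.comp (f := (f : ℝ ≃ₜ ℝ)) (g := (g : ℝ ≃ₜ ℝ)) ?_
        (g : ℝ ≃ₜ ℝ).continuous.continuousAt h
      exact (locallyAffineAt_bendFun (a / a') hy0).comp (f := fun x => 1 * x + p)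
        (continuous_bendFun _).continuousAt
        ⟨1, p, Eventually.of_forall fun _ => rfl⟩
    · exact (g : ℝ ≃ₜ ℝ).injective (h.trans hg0.symm)
  have hfin : (PLF.breaks f).Finite := f.2
  calc (PLF.breaks (f * g)).ncard
      ≤ ((g : ℝ ≃ₜ ℝ).symm '' (PLF.breaks f \ {p})).ncard :=
        Set.ncard_le_ncard hsub ((hfin.subset Set.sdiff_subset).image _)
    _ ≤ (PLF.breaks f \ {p}).ncard := Set.ncard_image_le (hfin.subset Set.sdiff_subset)
    _ < (PLF.breaks f).ncard := Set.ncard_sdiff_singleton_lt_of_mem hp hfin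

theorem mem_bendSubgroup_of_strictMono (f : PLF) (hf : StrictMono (f : ℝ ≃ₜ ℝ)) :
    f ∈ bendSubgroup := by
  induction h : (PLF.breaks f).ncard using Nat.strong_induction_on generalizing f with
  | _ n ih =>
    by_cases hb : (PLF.breaks f).Nonempty
    · obtain ⟨p, hp⟩ := hb
      obtain ⟨g, hg, hmono, hlt⟩ := PLF.exists_remove_break hf hp
      exact (Subgroup.mul_mem_cancel_right _ hg).1
        (ih _ (h ▸ hlt) (f * g) (hf.comp hmono) rfl)
    · obtain ⟨a, b, hab⟩ := exists_affine_of_locallyAffineAt (f := (f : ℝ ≃ₜ ℝ)) isOpen_univ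
        isPreconnected_univ fun x _ => by_contra fun hx => hb ⟨x, hx⟩
      have ha : 0 < a := hf.slope_pos zero_lt_one (hab 0 trivial) (hab 1 trivial)
      convert affine_mem_bendSubgroup_of_pos ha b using 1
      exact Subtype.ext (Homeomorph.ext fun x => hab x trivial)

/-! ### Generation of the whole group and conclusion -/

theorem bendSubgroup_eq_top : bendSubgroup = ⊤ := by
  refine (Subgroup.eq_top_iff' _).2 fun f => ?_
  rcases PLF.strictMono_or_strictAnti f with hf | hf
  · exact mem_bendSubgroup_of_strictMono f hf
  · refine (Subgroup.mul_mem_cancel_left _ (affine_neg_one_mem_bendSubgroup 0)).1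
      (mem_bendSubgroup_of_strictMono _ fun x y hxy => ?_)
    have h1 := hf hxy
    change -1 * (f : ℝ ≃ₜ ℝ) x + 0 < -1 * (f : ℝ ≃ₜ ℝ) y + 0
    linarith

theorem propositionP : (involutionSubgroup PLF : Set PLF) = PLE := by
  ext f
  rw [SetLike.mem_coe, mem_PLE_iff]
  refine ⟨gradientProduct_eq_one_of_mem_involutionSubgroup, fun hf => ?_⟩
  have hmem : f ∈ bendSubgroup := bendSubgroup_eq_top ▸ Subgroup.mem_top f
  -- Normality makes the join a plain product; bends form the image of a homomorphism, so a single
  -- bend suffices.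
  obtain ⟨n, hn, _, ⟨c, rfl⟩, rfl⟩ := Subgroup.mem_sup_of_normal_left.1 hmem
  rw [map_mul, gradientProduct_eq_one_of_mem_involutionSubgroup hn, one_mul,
    PLF.gradientProduct_bend] at hf
  rw [show c = 1 from Subtype.ext hf, map_one, mul_one]
  exact hn
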